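/- Let $M$ be the additive monoid $\mathbb{N}=\{0,1,2,\dots\}$ or $\mathbb{Z}$, let $k$ be a field of characteristic zero, and let $k_0\subseteq k$ be a computable subfield. For $\mathbf X=(X_1,\dots,X_n)$ let $k_0[\sigma^m(\mathbf X)\mid m\in M]$ be the polynomial ring over $k_0$ in the indeterminates $\sigma^m(X_i)$ ($1\le i\le n$, $m\in M$), on which $M$ acts by $k_0$-algebra endomorphisms with $\sigma^{m}(\sigma^{m'}(X_i))=\sigma^{m+m'}(X_i)$. Let $k^M$ be the ring of sequences $(x_l)_{l\in M}$ in $k$ with componentwise operations and $\sigma^m((x_l)_{l\in M})=(x_{l+m})_{l\in M}$. For $\mathbf x\in(k^M)^n$, let $f(\mathbf x)\in k^M$ be the image of $f$ under the ring homomorphism that sends $\sigma^m(X_i)$ to $\sigma^m(x_i)$ and each constant to the corresponding constant sequence. Then each of the following two problems is undecidable, that is, no algorithm solves it for all inputs, where an input consists of $n$, a finite list $f_1,\dots,f_\ell$ and an element $g$ of $k_0[\sigma^m(\mathbf X)\mid m\in M]$: (P1) Determine whether the system $f_1=\dots=f_\ell=0,\ g\neq 0$ has a solution in $k^M$, that is,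 whether there is $\mathbf x\in(k^M)^n$ with $f_1(\mathbf x)=\dots=f_\ell(\mathbf x)=0$ and $g(\mathbf x)\neq 0$ in $k^M$ (so $g(\mathbf x)$ is not the zero sequence). (P2) Determine whether $$g\in\sqrt{\langle \sigma^m(f_1),\dots,\sigma^m(f_\ell)\mid m\in M\rangle},$$ the radical being taken in $k_0[\sigma^m(\mathbf X)\mid m\in M]$. Here $k_0$ is computable if there is a surjection $\nu:\mathbb{N}\to k_0$ for which equality of the named elements is decidable and names of sums and products are computable from names of the operands. Polynomials are given to the algorithm as finite lists of terms, with coefficients given by names. The undecidability holds for every such $\nu$. -/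

import Mathlib

/-- A computable numbering of a field `F`: every element of `F` has at least one natural number
as a name, it is decidable whether two names denote the same element, and names of sums and of
products can be computed from names of the operands. (Negation and inversion are then
computable on names by unbounded search. A field is computable if and only if it has such a
numbering.) -/
structure IsComputableNumbering {F : Type*} [Field F] (ν : ℕ → F) : Prop where
  surjective : Function.Surjective ν
  eq_computable : ComputablePred fun p : ℕ × ℕ => ν p.1 = ν p.2
  add_computable : ∃ a : ℕ → ℕ → ℕ, Computable₂ a ∧ ∀ i j, ν (a i j) = ν i + ν j
  mul_computable : ∃ b : ℕ → ℕ → ℕ, Computable₂ b ∧ ∀ i j, ν (b i j) = ν i * ν j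

/-- The ring `R[σ^m(X₁), …, σ^m(Xₙ) | m ∈ M]` of difference polynomials over a ring `R` of
constants; the indeterminate `(i, m)` is `σ^m(Xᵢ)`. -/
abbrev DiffPoly (M R : Type*) [CommSemiring R] (n : ℕ) : Type _ :=
  MvPolynomial (Fin n × M) R

/-- The endomorphism `σ^m` of the ring of difference polynomials: it fixes the constants and
`σ^m(σ^m'(Xᵢ)) = σ^(m + m')(Xᵢ)`. -/
noncomputable def DiffPoly.shift {M R : Type*} [AddMonoid M] [CommSemiring R] {n : ℕ} (m : M) :
    DiffPoly M R n →ₐ[R] DiffPoly M R n :=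
  MvPolynomial.rename fun p => (p.1, m + p.2)

/-- The action of `M` on the ring of sequences `A^M`: `σ^m((x_l)_l) = (x_(l + m))_l`. -/
def seqShift {M A : Type*} [AddMonoid M] (m : M) (x : M → A) : M → A :=
  fun l => x (l + m)

/-- The value `f(x) ∈ A^M` of a difference polynomial `f` at a tuple `x ∈ (A^M)^n`, that is, the
image of `f` under the ring homomorphism that sends `σ^m(Xᵢ)` to `σ^m(xᵢ)` and a constant to the
corresponding constant sequence. -/
noncomputable def DiffPoly.eval {M R A : Type*} [AddMonoid M] [CommSemiring R] [CommSemiring A]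
    [Algebra R A] {n : ℕ} (x : Fin n → M → A) (f : DiffPoly M R n) : M → A :=
  MvPolynomial.aeval (fun p : Fin n × M => seqShift p.2 (x p.1)) f

/-- The system `f₁ = … = f_ℓ = 0`, `g ≠ 0` has a solution in sequences `A^M`. -/
def HasSolutionInSequences {M R : Type*} (A : Type*) [AddMonoid M] [CommSemiring R]
    [CommSemiring A] [Algebra R A] (n : ℕ) (fs : List (DiffPoly M R n)) (g : DiffPoly M R n) :
    Prop :=
  ∃ x : Fin n → M → A, (∀ f ∈ fs, DiffPoly.eval x f = 0) ∧ DiffPoly.eval x g ≠ 0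

/-- `g` lies in the radical of the ideal generated by all `σ^m(f₁), …, σ^m(f_ℓ)`, `m ∈ M`. -/
def MemRadicalDifferenceIdeal {M R : Type*} [AddMonoid M] [CommSemiring R] (n : ℕ)
    (fs : List (DiffPoly M R n)) (g : DiffPoly M R n) : Prop :=
  g ∈ (Ideal.span {h : DiffPoly M R n | ∃ m : M, ∃ f ∈ fs, h = DiffPoly.shift m f}).radical

/-- Finite expressions for difference polynomials in `n` variables: a list of terms, each of them
a name of its coefficient together with the list of the indeterminates `σ^m(Xᵢ)` that are
multiplied, repeated according to multiplicity. -/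
abbrev DiffPolyExpr (M : Type*) (n : ℕ) : Type _ := List (ℕ × List (Fin n × M))

/-- The difference polynomial that an expression denotes, coefficients being named by `ν`. -/
noncomputable def DiffPolyExpr.toPoly {M R : Type*} [CommSemiring R] (ν : ℕ → R) {n : ℕ}
    (e : DiffPolyExpr M n) : DiffPoly M R n :=
  (e.map fun t => MvPolynomial.C (ν t.1) *
    (t.2.map fun p => (MvPolynomial.X p : DiffPoly M R n)).prod).sum

/-- The same expression as input of an algorithm, variable indices being natural numbers. -/
def DiffPolyExpr.toInput {M : Type*} {n : ℕ} (e : DiffPolyExpr M n) :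
    List (ℕ × List (ℕ × M)) :=
  e.map fun t => (t.1, t.2.map fun p => ((p.1 : ℕ), p.2))

/-- Decidability of a problem `P` about difference polynomials `f₁, …, f_ℓ, g` in `n` variables:
there is an algorithm (a total computable function) which, given `n` and expressions for
`f₁, …, f_ℓ` and `g`, returns `true` if `P` holds and `false` otherwise. The numbers `n` and `ℓ`
are part of the input. -/
def IsDecidableDiffProblem {M R : Type*} [Primcodable M] [CommSemiring R] (ν : ℕ → R)
    (P : (n : ℕ) → List (DiffPoly M R n) → DiffPoly M R n → Prop) : Prop :=
  ∃ D : ℕ × List (List (ℕ × List (ℕ × M))) × List (ℕ × List (ℕ × M)) → Bool,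
    Computable D ∧
    ∀ (n : ℕ) (es : List (DiffPolyExpr M n)) (e : DiffPolyExpr M n),
      D (n, es.map DiffPolyExpr.toInput, e.toInput) = true ↔
        P n (es.map (DiffPolyExpr.toPoly ν)) (e.toPoly ν)

/-!
Both problems are undecidable because the halting problem for register machines reduces to them.

A configuration of a register machine, consisting of an instruction number and of finitely many
natural numbers, is a tuple of elements of a field of characteristic zero, and a run of the machine
is a tuple of sequences. That consecutive configurations are related by a step of a fixed program
can be expressed by polynomial equations in the unknowns and their shifts by `1`: the instruction
number takes finitely many values, so a polynomial in it selects the instruction to be executed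
(`Instr.guard`), and the only tests are for equality of registers, `δ = 0` with `δ` their
difference. With an auxiliary unknown `u` and the equation `δ * (1 - δ * u) = 0`, the value
`1 - δ * u` is `1` if `δ = 0` and `0` otherwise, in any domain. Two further conditions are imposed:
the halting configuration does not occur, and wherever an unknown `w` is not zero, the configuration
is the initial one for the input `m`. Of the coefficients of this system, only one depends on `m`.

If the machine halts on input `m`, then `w` lies in the radical of the difference ideal
(`DiffPoly.memRadicalDifferenceIdeal_of_halts`): modulo a prime ideal not containing `w` the
unknowns would be forced to follow the run until it reaches the excluded configuration. If it does
not halt, the run is a solution with `w ≠ 0` (`DiffPoly.hasSolutionInSequences_of_not_halts`). As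
there is no solution with `w ≠ 0` if `w` lies in the radical, the machine halts on input `m` exactly
if `w` lies in the radical, and exactly if there is no solution with `w ≠ 0`. On `ℤ` the places
before the start of the run get an instruction number of their own, for which the equations impose
nothing on the next place.

A machine with an undecidable halting problem (`exists_machine_not_computablePred`) is obtained by
compiling a while program that searches for a zero of a primitive recursive function `p (m, ·)`,
where `p (m, j) = 0` means that the `m`-th partial recursive function is found to halt on `0` within
the bound `j`.
-/

/-! ### Register machines and while programs -/

/-- Instructions of a register machine whose registers `0, 1, 2, …` hold natural numbers.
`lin d a p q` sets register `d` to `p` times register `a` plus `q`; `jeq a b t` jumps to the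
instruction with number `t` if registers `a` and `b` agree, and otherwise goes on to the next
instruction. -/
inductive Instr
  | lin (d a p q : ℕ)
  | jeq (a b t : ℕ)

namespace Instr

/-- One step of the machine with program `C`. A configuration consists of the number of the
instruction to be executed and the contents of the registers. Outside of `C` nothing happens. -/
def step (C : List Instr) (c : ℕ × (ℕ → ℕ)) : ℕ × (ℕ → ℕ) :=
  match C[c.1]? with
  | none => c
  | some (lin d a p q) => (c.1 + 1, Function.update c.2 d (p * c.2 a + q))
  | some (jeq a b t) => (if c.2 a = c.2 b then t else c.1 + 1, c.2)

/-- The configuration after `t` steps from instruction `0`, where register `0` holds `m` and all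
other registers hold `0`. -/
def run (C : List Instr) (m t : ℕ) : ℕ × (ℕ → ℕ) :=
  (step C)^[t] (0, Pi.single 0 m)

theorem run_zero (C : List Instr) (m : ℕ) : run C m 0 = (0, Pi.single 0 m) := rfl

theorem run_succ (C : List Instr) (m t : ℕ) : run C m (t + 1) = step C (run C m t) :=
  Function.iterate_succ_apply' _ _ _

/-- The machine with program `C` gets from configuration `c` to configuration `c'`. -/
def Reaches (C : List Instr) (c c' : ℕ × (ℕ → ℕ)) : Prop :=
  ∃ t, (step C)^[t] c = c'

theorem Reaches.refl (C : List Instr) (c : ℕ × (ℕ → ℕ)) : Reaches C c c := ⟨0, rfl⟩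

theorem Reaches.trans {C : List Instr} {c₁ c₂ c₃ : ℕ × (ℕ → ℕ)} :
    Reaches C c₁ c₂ → Reaches C c₂ c₃ → Reaches C c₁ c₃ := by
  rintro ⟨t, rfl⟩ ⟨u, rfl⟩
  exact ⟨u + t, Function.iterate_add_apply _ _ _ _⟩

theorem Reaches.head {C : List Instr} {c c₁ c₂ : ℕ × (ℕ → ℕ)} (h : step C c = c₁)
    (h' : Reaches C c₁ c₂) : Reaches C c c₂ :=
  Reaches.trans ⟨1, h⟩ h'

theorem iterate_step_of_length_le {C : List Instr} {c : ℕ × (ℕ → ℕ)} (h : C.length ≤ c.1)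
    (t : ℕ) : (step C)^[t] c = c :=
  Function.iterate_fixed (by simp [step, List.getElem?_eq_none h]) t

theorem run_eq_of_length_le {C : List Instr} {m t u : ℕ} (h : C.length ≤ (run C m t).1)
    (htu : t ≤ u) : run C m u = run C m t := by
  obtain ⟨v, rfl⟩ := Nat.exists_eq_add_of_le' htu
  exact (Function.iterate_add_apply _ _ _ _).trans (iterate_step_of_length_le h v)

theorem run_le_length {C : List Instr} {m : ℕ} (h : ∃ t, (run C m t).1 = C.length) (u : ℕ) :
    (run C m u).1 ≤ C.length := by
  obtain ⟨t, ht⟩ := h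
  by_contra hlt
  rcases le_total t u with htu | htu
  · rw [run_eq_of_length_le ht.ge htu, ht] at hlt
    exact hlt le_rfl
  · rw [run_eq_of_length_le (not_le.1 hlt).le htu] at ht
    exact hlt ht.le

/-- The list `D` of instructions occupies the positions from `e` on in the program `C`. -/
def Placed (C : List Instr) (e : ℕ) (D : List Instr) : Prop :=
  ∀ i < D.length, C[e + i]? = D[i]?

theorem Placed.left {C D D' : List Instr} {e : ℕ} (h : Placed C e (D ++ D')) : Placed C e D := by
  intro i hi
  rw [h i (by simp; omega), List.getElem?_append_left hi]

theorem Placed.right {C D D' : List Instr} {e : ℕ} (h : Placed C e (D ++ D')) :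
    Placed C (e + D.length) D' := by
  intro i hi
  have := h (D.length + i) (by simp; omega)
  rw [List.getElem?_append_right (by omega)] at this
  simpa [add_assoc] using this

theorem Placed.head {C D : List Instr} {I : Instr} {e : ℕ} (h : Placed C e (I :: D)) :
    C[e]? = some I := by
  simpa using h 0 (by simp)

theorem Placed.tail {C D : List Instr} {I : Instr} {e : ℕ} (h : Placed C e (I :: D)) :
    Placed C (e + 1) D :=
  Placed.right (D := [I]) h

end Instr

/-- While programs. `loop a b P` executes `P` as long as registers `a` and `b` differ. -/
inductive Prog
  | lin (d a p q : ℕ)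
  | seq (P Q : Prog)
  | loop (a b : ℕ) (P : Prog)

namespace Prog

open Instr

/-- The program `P`, started with register contents `s`, terminates with contents `s'`. -/
inductive Runs : Prog → (ℕ → ℕ) → (ℕ → ℕ) → Prop
  | lin (d a p q s) : Runs (lin d a p q) s (Function.update s d (p * s a + q))
  | seq {P Q s s' s''} : Runs P s s' → Runs Q s' s'' → Runs (seq P Q) s s''
  | finish {a b P s} : s a = s b → Runs (loop a b P) s s
  | loop {a b P s s' s''} : s a ≠ s b → Runs P s s' → Runs (loop a b P) s' s'' →
      Runs (loop a b P) s s''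

/-- The instructions of `P` when the first of them is to have the number `e`. -/
def code : Prog → ℕ → List Instr
  | lin d a p q, _ => [.lin d a p q]
  | seq P Q, e => P.code e ++ Q.code (e + (P.code e).length)
  | loop a b P, e =>
      .jeq a b (e + (P.code (e + 1)).length + 2) :: (P.code (e + 1) ++ [.jeq 0 0 e])

/-- One passage through the body of a loop, back to its head. -/
theorem reaches_loop_head {C : List Instr} {a b e : ℕ} {P : Prog} {s s' : ℕ → ℕ}
    (hC : Placed C e ((loop a b P).code e)) (h : s a ≠ s b)
    (hP : Reaches C (e + 1, s) (e + 1 + (P.code (e + 1)).length, s')) :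
    ∃ t, (step C)^[t + 1] (e, s) = (e, s') := by
  have h₁ : step C (e, s) = (e + 1, s) := by simp [step, hC.head, h]
  have h₂ : step C (e + 1 + (P.code (e + 1)).length, s') = (e, s') := by
    simp [step, hC.tail.right.head]
  obtain ⟨t, ht⟩ := hP.trans (Reaches.head h₂ (.refl _ _))
  exact ⟨t, by rw [Function.iterate_succ_apply, h₁, ht]⟩

theorem Runs.reaches {P : Prog} {s s' : ℕ → ℕ} (h : Runs P s s') :
    ∀ {C : List Instr} {e : ℕ}, Placed C e (P.code e) →
      Reaches C (e, s) (e + (P.code e).length, s') := by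
  induction h with
  | lin d a p q s =>
    intro C e hC
    exact ⟨1, by simp [step, hC.head, code]⟩
  | seq _ _ ih₁ ih₂ =>
    intro C e hC
    have := (ih₁ (Placed.left hC)).trans (ih₂ (Placed.right hC))
    simpa [code, add_assoc] using this
  | finish h =>
    intro C e hC
    exact ⟨1, by simp [step, hC.head, code, h, add_assoc]⟩
  | loop hne _ _ ih₁ ih₂ =>
    intro C e hC
    obtain ⟨t, ht⟩ := reaches_loop_head hC hne (ih₁ hC.tail.left)
    exact Reaches.trans ⟨_, ht⟩ (ih₂ hC)

/-- A loop whose condition is preserved by its body, which always terminates, never ends. -/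
theorem iterate_lt_length_of_invariant {C : List Instr} {a b e : ℕ} {P : Prog}
    (hC : Placed C e ((loop a b P).code e)) (Inv : (ℕ → ℕ) → Prop)
    (hInv : ∀ s, Inv s → s a ≠ s b ∧ ∃ s', Runs P s s' ∧ Inv s') {s : ℕ → ℕ} (hs : Inv s)
    (t : ℕ) : ((step C)^[t] (e, s)).1 < C.length := by
  have he : e < C.length := (List.getElem?_eq_some_iff.1 hC.head).1
  have key : ∀ t s, Inv s → ∃ u, t ≤ u ∧ ∃ s', Inv s' ∧ (step C)^[u] (e, s) = (e, s') := by
    intro t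
    induction t with
    | zero => exact fun s hs => ⟨0, le_rfl, s, hs, rfl⟩
    | succ t ih =>
      intro s hs
      obtain ⟨hne, s₁, hP, hs₁⟩ := hInv s hs
      obtain ⟨v, hv⟩ := reaches_loop_head hC hne (hP.reaches hC.tail.left)
      obtain ⟨u, hu, s', hs', h⟩ := ih s₁ hs₁
      exact ⟨u + (v + 1), by omega, s', hs', by rw [Function.iterate_add_apply, hv, h]⟩
  by_contra hlt
  obtain ⟨u, hu, s', -, h⟩ := key t s hs
  have := iterate_step_of_length_le (not_lt.1 hlt) (u - t)
  rw [← Function.iterate_add_apply, Nat.sub_add_cancel hu, h] at this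
  exact hlt (this ▸ he)

/-! ### Programs for primitive recursive functions -/

/-- For any choice of argument registers and of a result register below `B`, there is a program
that computes `f` and, below `B`, changes only the result register. -/
def Computes {n : ℕ} (f : List.Vector ℕ n → ℕ) : Prop :=
  ∀ (B out : ℕ) (ins : Fin n → ℕ), (∀ i, ins i < B) →
    ∃ P : Prog, ∀ s, ∃ s', Runs P s s' ∧ s' out = f (.ofFn fun i => s (ins i)) ∧
      ∀ r < B, r ≠ out → s' r = s r

theorem Computes.comp {m n : ℕ} {f : List.Vector ℕ n → ℕ} {g : Fin n → List.Vector ℕ m → ℕ}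
    (hf : Computes f) (hg : ∀ i, Computes (g i)) :
    Computes fun v => f (.ofFn fun i => g i v) := by
  intro B out ins hins
  -- The values of the `g i` go to the registers `B + i`.
  have key : ∀ j ≤ n, ∃ P : Prog, ∀ s, ∃ s', Runs P s s' ∧
      (∀ i : Fin n, i < j → s' (B + i) = g i (.ofFn fun l => s (ins l))) ∧
      ∀ r < B, s' r = s r := by
    intro j
    induction j with
    | zero =>
      intro _
      refine ⟨.lin 0 0 1 0, fun s => ⟨_, .lin .., ?_, ?_⟩⟩
      · simp
      · simp
    | succ j ih =>
      intro hj
      obtain ⟨P, hP⟩ := ih (by omega)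
      obtain ⟨Q, hQ⟩ := hg ⟨j, hj⟩ (B + n) (B + j) ins fun i => by have := hins i; omega
      refine ⟨.seq P Q, fun s => ?_⟩
      obtain ⟨s₁, h₁, hv₁, hk₁⟩ := hP s
      obtain ⟨s₂, h₂, hv₂, hk₂⟩ := hQ s₁
      refine ⟨s₂, .seq h₁ h₂, fun i hi => ?_, fun r hr => ?_⟩
      · rcases eq_or_ne (i : ℕ) j with hij | hij
        · obtain rfl : i = ⟨j, hj⟩ := Fin.ext hij
          simp only [hv₂, hk₁ _ (hins _)]
        · rw [hk₂ _ (by omega) (by omega), hv₁ i (by omega)]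
      · rw [hk₂ _ (by omega) (by omega), hk₁ r hr]
  obtain ⟨P, hP⟩ := key n le_rfl
  obtain ⟨Q, hQ⟩ := hf (B + n) out (fun i => B + i) fun i => by omega
  refine ⟨.seq P Q, fun s => ?_⟩
  obtain ⟨s₁, h₁, hv₁, hk₁⟩ := hP s
  obtain ⟨s₂, h₂, hv₂, hk₂⟩ := hQ s₁
  refine ⟨s₂, .seq h₁ h₂, ?_, fun r hr hro => ?_⟩
  · simp only [hv₂, fun i : Fin n => hv₁ i i.2]
  · rw [hk₂ _ (by omega) hro, hk₁ r hr]

theorem Computes.prec {n : ℕ} {f : List.Vector ℕ n → ℕ} {g : List.Vector ℕ (n + 2) → ℕ}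
    (hf : Computes f) (hg : Computes g) :
    Computes fun v : List.Vector ℕ (n + 1) =>
      v.head.rec (f v.tail) fun y IH => g (y ::ᵥ IH ::ᵥ v.tail) := by
  intro B out ins hins
  -- Register `B` accumulates the value and register `B + 1` counts the passages of the loop.
  obtain ⟨P, hP⟩ := hf (B + 2) B (fun i => ins i.succ) fun i => by
    have := hins i.succ; omega
  obtain ⟨Q, hQ⟩ := hg (B + 2) B (Fin.cons (B + 1) (Fin.cons B fun i => ins i.succ)) fun i => by
    refine Fin.cases (by simp) (fun i => Fin.cases (by simp) (fun i => ?_) i) i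
    have := hins i.succ
    simp only [Fin.cons_succ]
    omega
  refine ⟨.seq P (.seq (.lin (B + 1) 0 0 0) (.seq
    (.loop (B + 1) (ins 0) (.seq Q (.lin (B + 1) (B + 1) 1 1))) (.lin out B 1 0))), fun s => ?_⟩
  set v : List.Vector ℕ n := .ofFn fun i => s (ins i.succ) with hv
  set F : ℕ → ℕ := fun y => Nat.rec (f v) (fun y IH => g (y ::ᵥ IH ::ᵥ v)) y with hF
  have loop_runs : ∀ j y (s₁ : ℕ → ℕ), y + j = s (ins 0) → s₁ (B + 1) = y → s₁ B = F y →
      (∀ r < B, s₁ r = s r) →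
      ∃ s₂, Runs (.loop (B + 1) (ins 0) (.seq Q (.lin (B + 1) (B + 1) 1 1))) s₁ s₂ ∧
        s₂ B = F (s (ins 0)) ∧ ∀ r < B, s₂ r = s r := by
    intro j
    induction j with
    | zero =>
      intro y s₁ hy hc ha hk
      refine ⟨s₁, .finish ?_, ?_, hk⟩
      · rw [hc, hk _ (hins 0)]; omega
      · rw [ha, ← hy, add_zero]
    | succ j ih =>
      intro y s₁ hy hc ha hk
      obtain ⟨s₂, h₂, hv₂, hk₂⟩ := hQ s₁
      have hg₂ : s₂ B = F (y + 1) := by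
        rw [hv₂]
        change _ = g (y ::ᵥ F y ::ᵥ v)
        congr 1
        simp [List.Vector.ofFn, hc, ha, hv, hk _ (hins _)]
      have hk₂' : ∀ r < B, s₂ r = s r := fun r hr => by
        rw [hk₂ r (by omega) (by omega), hk r hr]
      have hc₂ : s₂ (B + 1) = y := by rw [hk₂ _ (by omega) (by omega), hc]
      obtain ⟨s₃, h₃, hv₃, hk₃⟩ := ih (y + 1) (Function.update s₂ (B + 1) (1 * s₂ (B + 1) + 1))
        (by omega) (by simp [hc₂]) (by simp [hg₂])
        (fun r hr => by rw [Function.update_of_ne (by omega), hk₂' r hr])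
      refine ⟨s₃, .loop ?_ (.seq h₂ (.lin ..)) h₃, hv₃, hk₃⟩
      rw [hc, hk _ (hins 0)]; omega
  obtain ⟨s₁, h₁, hv₁, hk₁⟩ := hP s
  obtain ⟨s₂, h₂, hv₂, hk₂⟩ := loop_runs (s (ins 0)) 0
    (Function.update s₁ (B + 1) (0 * s₁ 0 + 0)) (by simp) (by simp)
    (by simp [hv₁, hF, hv]) fun r hr => by
      rw [Function.update_of_ne (by omega), hk₁ r (by omega) (by omega)]
  refine ⟨_, .seq h₁ (.seq (.lin ..) (.seq h₂ (.lin ..))), ?_, fun r hr hro => ?_⟩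
  · simp [hv₂, hF, hv, List.Vector.ofFn]
  · rw [Function.update_of_ne hro, hk₂ r hr]

theorem computes_of_primrec' {n : ℕ} {f : List.Vector ℕ n → ℕ} (hf : Nat.Primrec' f) :
    Computes f := by
  induction hf with
  | zero =>
    exact fun B out ins _ => ⟨.lin out 0 0 0, fun s => ⟨_, .lin .., by simp, fun r _ hr => by
      simp [hr]⟩⟩
  | succ =>
    exact fun B out ins _ => ⟨.lin out (ins 0) 1 1, fun s => ⟨_, .lin .., by
      simp [List.Vector.ofFn], fun r _ hr => by simp [hr]⟩⟩
  | get i =>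
    exact fun B out ins _ => ⟨.lin out (ins i) 1 0, fun s => ⟨_, .lin .., by simp, fun r _ hr => by
      simp [hr]⟩⟩
  | comp g _ _ hf hg => exact hf.comp hg
  | prec _ _ hf hg => exact hf.prec hg

end Prog

/-! ### An undecidable halting problem for register machines -/

/-- The halting problem is the existence of a zero of a primitive recursive function. -/
theorem exists_primrec_not_computablePred :
    ∃ p : List.Vector ℕ 2 → ℕ, Nat.Primrec' p ∧
      ¬ ComputablePred fun m : ℕ => ∃ j, p (m ::ᵥ j ::ᵥ .nil) = 0 := by
  open Nat.Partrec in
  let p : List.Vector ℕ 2 → ℕ := fun v =>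
    if (Code.evaln v.tail.head (Denumerable.ofNat Code v.head) 0).isSome then 0 else 1
  refine ⟨p, .of_prim ?_, fun h => ComputablePred.halting_problem 0 ?_⟩
  · have h₁ : Primrec fun v : List.Vector ℕ 2 =>
        (Code.evaln v.tail.head (Denumerable.ofNat Code v.head) 0).isSome :=
      Primrec.option_isSome.comp (Code.primrec_evaln.comp
        (((Primrec.vector_head.comp Primrec.vector_tail).pair
          ((Primrec.ofNat Code).comp Primrec.vector_head)).pair (Primrec.const 0)))
    exact Primrec.ite (Primrec.eq.comp h₁ (Primrec.const true)) (Primrec.const 0)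
      (Primrec.const 1)
  · obtain ⟨f, hf, hfe⟩ := ComputablePred.computable_iff.1 h
    refine ComputablePred.computable_iff.2 ⟨_, hf.comp Computable.encode, ?_⟩
    funext c
    rw [← congrFun hfe (Encodable.encode c)]
    simp only [p, List.Vector.head_cons, List.Vector.tail_cons, Denumerable.ofNat_encode,
      ite_eq_left_iff, one_ne_zero, imp_false, not_not, Option.isSome_iff_exists, Part.dom_iff_mem,
      Code.evaln_complete]
    exact propext exists_comm

/-- The program looks for a zero of a primitive recursive function by trying all numbers. -/
theorem exists_machine_not_computablePred :
    ∃ (K : ℕ → Prop) (C : List Instr), ¬ ComputablePred K ∧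
      (∀ m, K m → ∃ t, (Instr.run C m t).1 = C.length) ∧
      ∀ m, ¬ K m → ∀ t, (Instr.run C m t).1 < C.length := by
  obtain ⟨p, hp, hK⟩ := exists_primrec_not_computablePred
  -- Register `0` holds the input `m`, register `1` the candidate `j`, register `2` the value
  -- `p (m, j)`, and register `3` remains `0`.
  obtain ⟨P, hP⟩ := Prog.computes_of_primrec' hp 4 2 (fun i => (i : ℕ)) fun i => by omega
  replace hP : ∀ s, ∃ s', Prog.Runs P s s' ∧ s' 2 = p (s 0 ::ᵥ s 1 ::ᵥ .nil) ∧
      s' 0 = s 0 ∧ s' 1 = s 1 ∧ s' 3 = s 3 := fun s => by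
    obtain ⟨s', h, hv, hk⟩ := hP s
    exact ⟨s', h, by simpa [List.Vector.ofFn] using hv, hk 0 (by omega) (by omega),
      hk 1 (by omega) (by omega), hk 3 (by omega) (by omega)⟩
  let L : Prog := .loop 2 3 (.seq (.lin 1 1 1 1) P)
  have body : ∀ s, ∃ s', Prog.Runs (.seq (.lin 1 1 1 1) P) s s' ∧
      s' 2 = p (s 0 ::ᵥ (s 1 + 1) ::ᵥ .nil) ∧ s' 0 = s 0 ∧ s' 1 = s 1 + 1 ∧
      s' 3 = s 3 := fun s => by
    obtain ⟨s', h, h₂, h₀, h₁, h₃⟩ := hP (Function.update s 1 (1 * s 1 + 1))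
    exact ⟨s', .seq (.lin ..) h, by simpa using h₂, by simpa using h₀, by simpa using h₁,
      by simpa using h₃⟩
  have hC : Instr.Placed ((Prog.seq P L).code 0) 0 ((Prog.seq P L).code 0) :=
    fun i _ => by rw [zero_add]
  refine ⟨_, (Prog.seq P L).code 0, hK, fun m ⟨j, hj⟩ => ?_, fun m hm t => ?_⟩
  · have loop_runs : ∀ d i (s : ℕ → ℕ), i + d = j → s 0 = m → s 1 = i →
        s 2 = p (m ::ᵥ i ::ᵥ .nil) → s 3 = 0 → ∃ s', Prog.Runs L s s' := by
      intro d
      induction d with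
      | zero =>
        intro i s hi h₀ h₁ h₂ h₃
        rw [add_zero] at hi
        exact ⟨s, .finish (by rw [h₂, h₃, hi, hj])⟩
      | succ d ih =>
        intro i s hi h₀ h₁ h₂ h₃
        by_cases heq : s 2 = s 3
        · exact ⟨s, .finish heq⟩
        · obtain ⟨s', h, h₂', h₀', h₁', h₃'⟩ := body s
          obtain ⟨s'', h'⟩ := ih (i + 1) s' (by omega) (h₀'.trans h₀) (h₁'.trans (by rw [h₁]))
            (by rw [h₂', h₀, h₁]) (h₃'.trans h₃)
          exact ⟨s'', .loop heq h h'⟩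
    obtain ⟨s₁, h₁, hv₂, hv₀, hv₁, hv₃⟩ := hP (Pi.single 0 m)
    obtain ⟨s₂, h₂⟩ := loop_runs j 0 s₁ (by simp) (by simp [hv₀]) (by simp [hv₁])
      (by simp [hv₂]) (by simp [hv₃])
    obtain ⟨t, ht⟩ := (Prog.Runs.seq h₁ h₂).reaches hC
    exact ⟨t, by rw [Instr.run, ht, zero_add]⟩
  · push Not at hm
    obtain ⟨s₁, h₁, hv₂, hv₀, hv₁, hv₃⟩ := hP (Pi.single 0 m)
    obtain ⟨u, hu⟩ := h₁.reaches hC.left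
    by_contra hlt
    have h := not_lt.1 hlt
    rw [← Instr.run_eq_of_length_le h (Nat.le_add_right t u), Instr.run,
      Function.iterate_add_apply, hu] at h
    refine absurd (Prog.iterate_lt_length_of_invariant hC.right
      (fun s => s 0 = m ∧ s 2 = p (m ::ᵥ s 1 ::ᵥ .nil) ∧ s 3 = 0) ?_ ?_ t) (not_lt.2 h)
    · rintro s ⟨h₀, h₂, h₃⟩
      refine ⟨by rw [h₂, h₃]; exact hm _, ?_⟩
      obtain ⟨s', hs', h₂', h₀', h₁', h₃'⟩ := body s
      exact ⟨s', hs', h₀'.trans h₀, by rw [h₂', h₁', h₀], h₃'.trans h₃⟩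
    · exact ⟨by simp [hv₀], by simp [hv₂, hv₁], by simp [hv₃]⟩

/-! ### Polynomial equations for the steps of a register machine -/

namespace Instr

/-- For a program of length `N`, the polynomial in `y` that vanishes at all numbers up to `N + 1`
other than `i`, so that in characteristic zero it does not vanish at `i`. -/
def guard {A : Type*} [CommRing A] (N i : ℕ) (y : A) : A :=
  ∏ j ∈ (Finset.range (N + 2)).erase i, (y - j)

theorem guard_natCast_ne_zero {A : Type*} [CommRing A] [IsDomain A] [CharZero A] (N i : ℕ) :
    guard N i (i : A) ≠ 0 := by
  refine Finset.prod_ne_zero_iff.2 fun j hj => sub_ne_zero.2 fun h => ?_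
  exact Finset.ne_of_mem_erase hj (Nat.cast_injective h).symm

theorem guard_natCast_eq_zero {A : Type*} [CommRing A] {N i j : ℕ} (hj : j < N + 2)
    (hij : j ≠ i) : guard N i (j : A) = 0 :=
  Finset.prod_eq_zero (Finset.mem_erase.2 ⟨hij, Finset.mem_range.2 hj⟩) (sub_self _)

theorem map_guard {A B : Type*} [CommRing A] [CommRing B] (φ : A →+* B) (N i : ℕ) (y : A) :
    φ (guard N i y) = guard N i (φ y) := by
  simp [guard]

/-- The registers that the instruction reads are among the first `R` ones. -/
def Below (R : ℕ) : Instr → Prop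
  | lin _ a _ _ => a < R
  | jeq a b _ => a < R ∧ b < R

theorem exists_below (C : List Instr) : ∃ R, 0 < R ∧ ∀ I ∈ C, Below R I := by
  induction C with
  | nil => exact ⟨1, one_pos, by simp⟩
  | cons I C ih =>
    obtain ⟨R, hR, h⟩ := ih
    have mono : ∀ {R R' : ℕ} {I : Instr}, R ≤ R' → Below R I → Below R' I := by
      rintro R R' (_ | _) hle h
      · exact lt_of_lt_of_le h hle
      · exact ⟨h.1.trans_le hle, h.2.trans_le hle⟩
    obtain ⟨R', hR'⟩ : ∃ R', Below R' I := by
      rcases I with ⟨d, a, p, q⟩ | ⟨a, b, t⟩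
      · exact ⟨a + 1, Nat.lt_succ_self a⟩
      · exact ⟨a + b + 1, by simp only [Below]; omega⟩
    refine ⟨R + R', by omega, fun J hJ => ?_⟩
    rcases List.mem_cons.1 hJ with rfl | hJ
    · exact mono (by omega) hR'
    · exact mono (by omega) (h J hJ)

/-- The equations that make `y` the successor of `x` if the instruction `I`, the `i`-th one of a
program of length `N`, is to be executed. Here `x 0` and `y 0` are the instruction numbers and
`x (r + 3)` and `y (r + 3)` are the contents of register `r < R`. In a domain the equation
`δ * (1 - δ * x 1) = 0` means that `1 - δ * x 1` is `1` or `0` according as `δ` is zero or not. -/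
def instrEqs {A : Type*} [CommRing A] (N R i : ℕ) (x y : ℕ → A) : Instr → List A
  | lin d a p q =>
      guard N i (x 0) * (y 0 - (i + 1)) ::
        (List.range R).map fun r =>
          guard N i (x 0) * (y (r + 3) - if r = d then p * x (a + 3) + q else x (r + 3))
  | jeq a b t =>
      guard N i (x 0) * ((x (a + 3) - x (b + 3)) * (1 - (x (a + 3) - x (b + 3)) * x 1)) ::
      guard N i (x 0) * (y 0 - (t * (1 - (x (a + 3) - x (b + 3)) * x 1) +
        (i + 1) * ((x (a + 3) - x (b + 3)) * x 1))) ::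
        (List.range R).map fun r => guard N i (x 0) * (y (r + 3) - x (r + 3))

/-- The equations for two consecutive configurations `x` and `y` of the program `C`: it has not
halted, `y` is the successor of `x`, and if `x 2 ≠ 0`, then `x` has instruction number `0` and
registers other than register `0` are `0`. -/
def stepEqs {A : Type*} [CommRing A] (C : List Instr) (R : ℕ) (x y : ℕ → A) : List A :=
  guard C.length C.length (x 0) :: x 2 * x 0 ::
    (((List.range R).map fun r => if r = 0 then 0 else x 2 * x (r + 3)) ++
      C.zipIdx.flatMap fun I => instrEqs C.length R I.2 x y I.1)

theorem map_stepEqs {A B : Type*} [CommRing A] [CommRing B] (φ : A →+* B) (C : List Instr)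
    (R : ℕ) (x y : ℕ → A) :
    (stepEqs C R x y).map φ = stepEqs C R (fun j => φ (x j)) (fun j => φ (y j)) := by
  have h : ∀ i I, (instrEqs C.length R i x y I).map φ =
      instrEqs C.length R i (fun j => φ (x j)) (fun j => φ (y j)) I := by
    rintro i (_ | _) <;> simp [instrEqs, map_guard, Function.comp_def, apply_ite φ]
  simp [stepEqs, map_guard, List.map_flatMap, Function.comp_def, apply_ite φ, h]

theorem forall_stepEqs_eq_zero {A : Type*} [CommRing A] {C : List Instr} {R : ℕ} {x y : ℕ → A} :
    (∀ e ∈ stepEqs C R x y, e = 0) ↔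
      guard C.length C.length (x 0) = 0 ∧ x 2 * x 0 = 0 ∧
        (∀ r < R, r ≠ 0 → x 2 * x (r + 3) = 0) ∧
        ∀ i I, C[i]? = some I → ∀ e ∈ instrEqs C.length R i x y I, e = 0 := by
  simp only [stepEqs, List.forall_mem_cons, List.forall_mem_append, List.forall_mem_map,
    List.mem_range, List.mem_flatMap, Prod.exists, List.mem_zipIdx_iff_getElem?]
  refine and_congr_right fun _ => and_congr_right fun _ => and_congr ?_ ?_
  · simp
  · exact ⟨fun h i I hI e he => h e ⟨I, i, hI, he⟩, fun h e ⟨I, i, hI, he⟩ => h i I hI e he⟩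

/-- `x` represents the configuration `c`, as far as the first `R` registers are concerned. -/
def Represents {A : Type*} [CommRing A] (R : ℕ) (x : ℕ → A) (c : ℕ × (ℕ → ℕ)) : Prop :=
  x 0 = c.1 ∧ ∀ r < R, x (r + 3) = c.2 r

theorem Represents.step {A : Type*} [CommRing A] [IsDomain A] [CharZero A] {C : List Instr}
    {R : ℕ} (hR : ∀ I ∈ C, Below R I) {x y : ℕ → A} {c : ℕ × (ℕ → ℕ)} (hc : c.1 < C.length)
    (h : ∀ e ∈ stepEqs C R x y, e = 0) (hx : Represents R x c) :
    Represents R y (Instr.step C c) := by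
  obtain ⟨i, s⟩ := c
  obtain ⟨hx₀, hxr⟩ := hx
  have hI : C[i]? = some C[i] := List.getElem?_eq_getElem hc
  have hb := hR _ (List.getElem_mem hc)
  have he := (forall_stepEqs_eq_zero.1 h).2.2.2 i _ hI
  have hG : guard C.length i (x 0) ≠ 0 := hx₀ ▸ guard_natCast_ne_zero _ _
  generalize C[i] = I at hI hb he
  rcases I with ⟨d, a, p, q⟩ | ⟨a, b, t⟩
  · simp only [instrEqs, List.forall_mem_cons, List.forall_mem_map, List.mem_range, mul_eq_zero, hG,
      false_or, sub_eq_zero] at he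
    simp only [Instr.step, hI]
    refine ⟨by simp [he.1], fun r hr => ?_⟩
    rw [he.2 r hr]
    by_cases hrd : r = d
    · subst hrd; simp [hxr a hb]
    · simp [hrd, hxr r hr]
  · simp only [instrEqs, List.forall_mem_cons, List.forall_mem_map, List.mem_range, mul_eq_zero, hG,
      false_or, sub_eq_zero, hxr a hb.1, hxr b hb.2] at he
    obtain ⟨h₁, h₂, h₃⟩ := he
    simp only [Instr.step, hI]
    refine ⟨?_, fun r hr => by rw [h₃ r hr, hxr r hr]⟩
    rw [h₂]
    by_cases hab : s a = s b
    · simp [hab]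
    · have := h₁.resolve_left fun h => hab (Nat.cast_injective h)
      simp [hab, ← this]

/-- The value that the auxiliary unknown `x 1` is given at the configuration `c`. It is read only
at jumps and there inverts the difference of the two registers, unless this is zero. -/
def auxValue (A : Type*) [Field A] (C : List Instr) (c : ℕ × (ℕ → ℕ)) : A :=
  match C[c.1]? with
  | some (jeq a b _) => ((c.2 a : A) - c.2 b)⁻¹
  | _ => 0

theorem instrEqs_eq_zero_of_guard_eq_zero {A : Type*} [CommRing A] {N R i : ℕ} {x y : ℕ → A}
    {I : Instr} (h : guard N i (x 0) = 0) : ∀ e ∈ instrEqs N R i x y I, e = 0 := by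
  rcases I with _ | _ <;> simp [instrEqs, h]

theorem Represents.instrEqs_eq_zero {A : Type*} [Field A] [CharZero A] {C : List Instr}
    {R : ℕ} (hR : ∀ I ∈ C, Below R I) {x y : ℕ → A} {c : ℕ × (ℕ → ℕ)} (hc : c.1 < C.length)
    (hx : Represents R x c) (hx₁ : x 1 = auxValue A C c) (hy : Represents R y (Instr.step C c))
    {i : ℕ} {I : Instr} (hI : C[i]? = some I) : ∀ e ∈ instrEqs C.length R i x y I, e = 0 := by
  obtain ⟨pc, s⟩ := c
  obtain ⟨hx₀, hxr⟩ := hx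
  rcases ne_or_eq pc i with hne | rfl
  · have hG : guard C.length i (x 0) = 0 := hx₀ ▸ guard_natCast_eq_zero (by omega) hne
    exact instrEqs_eq_zero_of_guard_eq_zero hG
  · obtain ⟨hy₀, hyr⟩ := hy
    have hb := hR _ (List.mem_of_getElem? hI)
    rcases I with ⟨d, a, p, q⟩ | ⟨a, b, t⟩
    · simp only [Instr.step, hI] at hy₀ hyr
      simp only [instrEqs, List.forall_mem_cons, List.forall_mem_map, List.mem_range, hy₀]
      refine ⟨by simp, fun r hr => ?_⟩
      rw [hyr r hr, hxr r hr, hxr a hb]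
      by_cases hrd : r = d
      · subst hrd; simp
      · simp [hrd]
    · simp only [Instr.step, hI] at hy₀ hyr
      simp only [auxValue, hI] at hx₁
      simp only [instrEqs, List.forall_mem_cons, List.forall_mem_map, List.mem_range, hy₀, hx₁,
        hxr a hb.1, hxr b hb.2]
      refine ⟨?_, ?_, fun r hr => by rw [hyr r hr, hxr r hr, sub_self, mul_zero]⟩
      · by_cases hab : (s a : A) - s b = 0
        · simp [hab]
        · simp [mul_inv_cancel₀ hab]
      · by_cases hab : s a = s b
        · simp [hab]
        · have : (s a : A) - s b ≠ 0 := sub_ne_zero.2 fun h => hab (Nat.cast_injective h)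
          simp [hab, mul_inv_cancel₀ this]

/-- At an inactive place, marked by the instruction number `C.length + 1`, every `y` is allowed to
follow. -/
theorem stepEqs_eq_zero_of_inactive {A : Type*} [CommRing A] {C : List Instr} {R : ℕ}
    {x y : ℕ → A} (hx₀ : x 0 = (C.length + 1 : ℕ)) (hx₂ : x 2 = 0) :
    ∀ e ∈ stepEqs C R x y, e = 0 := by
  have hguard : ∀ i < C.length + 1, Instr.guard C.length i (x 0) = 0 := fun i hi =>
    hx₀ ▸ guard_natCast_eq_zero (by omega) (by omega)
  refine forall_stepEqs_eq_zero.2 ⟨hguard _ (by omega), by simp [hx₂], by simp [hx₂],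
    fun i I hI => instrEqs_eq_zero_of_guard_eq_zero (hguard i ?_)⟩
  have := (List.getElem?_eq_some_iff.1 hI).1
  omega

theorem Represents.stepEqs_eq_zero {A : Type*} [Field A] [CharZero A] {C : List Instr}
    {R : ℕ} (hR : ∀ I ∈ C, Below R I) {x y : ℕ → A} {c : ℕ × (ℕ → ℕ)} (hc : c.1 < C.length)
    (hx : Represents R x c) (hx₁ : x 1 = auxValue A C c)
    (hx₂ : x 2 = 0 ∨ c.1 = 0 ∧ ∀ r ≠ 0, c.2 r = 0) (hy : Represents R y (Instr.step C c)) :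
    ∀ e ∈ stepEqs C R x y, e = 0 := by
  refine forall_stepEqs_eq_zero.2 ⟨?_, ?_, fun r hr hr₀ => ?_, fun i I hI =>
    hx.instrEqs_eq_zero hR hc hx₁ hy hI⟩
  · rw [hx.1]
    exact guard_natCast_eq_zero (by omega) hc.ne
  · rcases hx₂ with h | ⟨h, -⟩ <;> simp [h, hx.1]
  · rcases hx₂ with h | ⟨-, h⟩
    · simp [h]
    · simp [hx.2 r hr, h r hr₀]

end Instr

/-! ### Difference polynomials and their values in sequences -/

namespace DiffPoly

open MvPolynomial

section Eval

variable {M R A : Type*} [AddMonoid M] [CommSemiring R] [CommSemiring A] [Algebra R A] {n : ℕ}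

theorem eval_apply (x : Fin n → M → A) (f : DiffPoly M R n) (l : M) :
    DiffPoly.eval x f l = aeval (fun p : Fin n × M => x p.1 (l + p.2)) f := by
  change (Pi.evalAlgHom R (fun _ : M => A) l) (aeval _ f) = _
  rw [← AlgHom.comp_apply, comp_aeval]
  rfl

theorem aeval_shift (y : Fin n × M → A) (m : M) (f : DiffPoly M R n) :
    aeval y (DiffPoly.shift m f) = aeval (fun p => y (p.1, m + p.2)) f := by
  simp [DiffPoly.shift, aeval_rename, Function.comp_def]

end Eval

/-- Evaluation at a place of a solution annihilates the difference ideal, and hence its radical. -/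
theorem not_hasSolutionInSequences_of_memRadicalDifferenceIdeal {M R : Type*} (A : Type*)
    [AddMonoid M] [CommRing R] [CommRing A] [IsDomain A] [Algebra R A] {n : ℕ}
    {fs : List (DiffPoly M R n)} {g : DiffPoly M R n} (h : MemRadicalDifferenceIdeal n fs g) :
    ¬ HasSolutionInSequences A n fs g := by
  rintro ⟨x, hx, hg⟩
  refine hg (funext fun l => ?_)
  rw [eval_apply]
  have hle : Ideal.span {h : DiffPoly M R n | ∃ m : M, ∃ f ∈ fs, h = DiffPoly.shift m f} ≤
      RingHom.ker (aeval (R := R) fun p : Fin n × M => x p.1 (l + p.2)) := by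
    refine Ideal.span_le.2 ?_
    rintro _ ⟨m, f, hf, rfl⟩
    have := congrFun (hx f hf) (l + m)
    rw [eval_apply] at this
    simpa [aeval_shift, add_assoc] using this
  exact (RingHom.ker_isPrime _).isRadical.radical_le_iff.2 hle h

/-- The unknown number `j < R + 3`, shifted by `m`. The unknowns are: `0` for the instruction
number, `1` for the inverses that occur in tests, `2` for marking the start of the run, and `r + 3`
for register `r < R`. Larger `j` are read modulo `R + 3`. -/
noncomputable def unknown {M F : Type*} [CommSemiring F] (R : ℕ) (m : M) (j : ℕ) :
    DiffPoly M F (R + 3) :=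
  X (Fin.ofNat (R + 3) j, m)

/-! ### The system attached to a register machine and an input -/

section System

variable {M F : Type*} [AddMonoidWithOne M] [Field F]

open Instr

/-- The part of the system that does not depend on the input: it relates the configurations at
any two consecutive places. -/
noncomputable def stepSystem (M F : Type*) [AddMonoidWithOne M] [Field F] (C : List Instr)
    (R : ℕ) : List (DiffPoly M F (R + 3)) :=
  stepEqs C R (unknown R 0) (unknown R 1)

/-- The equation saying that register `0` holds `m` wherever unknown `2` does not vanish. -/
noncomputable def inputEq (M F : Type*) [AddMonoidWithOne M] [Field F] (R m : ℕ) :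
    DiffPoly M F (R + 3) :=
  unknown R 0 2 * unknown R 0 3 + C (-(m : F)) * unknown R 0 2

/-- If the machine halts on input `m`, then the unknown `2` lies in the radical: modulo a prime
ideal that contains the difference ideal but not this unknown, the unknowns would follow the run
of the machine from place `0` on, up to a halting configuration, which the system excludes. -/
theorem memRadicalDifferenceIdeal_of_halts [CharZero F] {C : List Instr} {R : ℕ}
    (hR : ∀ I ∈ C, Below R I) {m : ℕ} (hm : ∃ t, (run C m t).1 = C.length) :
    MemRadicalDifferenceIdeal (R + 3) (inputEq M F R m :: stepSystem M F C R)
      (unknown R 0 2) := by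
  rw [MemRadicalDifferenceIdeal, Ideal.radical_eq_sInf, Ideal.mem_sInf]
  rintro P ⟨hP, hprime⟩
  by_contra hw
  let L := DiffPoly M F (R + 3) ⧸ P
  have : CharZero L := charZero_of_injective_algebraMap (algebraMap F L).injective
  let y : ℕ → M → L := fun j l => Ideal.Quotient.mk P (unknown R l j)
  have aeval_eq : ∀ (t : ℕ) (f : DiffPoly M F (R + 3)),
      Ideal.Quotient.mk P (DiffPoly.shift (t : M) f) =
        aeval (fun p : Fin (R + 3) × M => y p.1 (t + p.2)) f := by
    intro t f
    have h : (Ideal.Quotient.mkₐ F P).comp (DiffPoly.shift (t : M)) =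
        aeval (fun p : Fin (R + 3) × M => y p.1 (t + p.2)) := by
      refine MvPolynomial.algHom_ext fun p => ?_
      simp [DiffPoly.shift, y, unknown]
    exact DFunLike.congr_fun h f
  have unknown_eq : ∀ (t : ℕ) (l : M) (j : ℕ),
      aeval (fun p : Fin (R + 3) × M => y p.1 (t + p.2)) (unknown (F := F) R l j) =
        y j (t + l) := by
    intro t l j
    simp [unknown, y]
  -- the system holds at every place `t` for the residue classes `y` of the unknowns
  have sys : ∀ t : ℕ, ∀ f ∈ inputEq M F R m :: stepSystem M F C R,
      aeval (fun p : Fin (R + 3) × M => y p.1 (t + p.2)) f = 0 := by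
    intro t f hf
    rw [← aeval_eq, Ideal.Quotient.eq_zero_iff_mem]
    exact hP (Ideal.subset_span ⟨t, f, hf, rfl⟩)
  have hstep : ∀ t : ℕ, ∀ e ∈ stepEqs C R (fun j => y j t) (fun j => y j ((t + 1 : ℕ) : M)),
      e = 0 := by
    intro t e he
    have := map_stepEqs (aeval (fun p : Fin (R + 3) × M => y p.1 (t + p.2)) :
      DiffPoly M F (R + 3) →ₐ[F] L).toRingHom C R (unknown R 0) (unknown R 1)
    simp only [AlgHom.toRingHom_eq_coe, RingHom.coe_coe, unknown_eq, add_zero] at this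
    rw [Nat.cast_succ, ← this, List.mem_map] at he
    obtain ⟨f, hf, rfl⟩ := he
    exact sys t f (List.mem_cons_of_mem _ hf)
  have hinput := sys 0 _ List.mem_cons_self
  simp only [inputEq, map_add, map_mul, unknown_eq, map_neg, map_natCast] at hinput
  simp only [Nat.cast_zero, add_zero] at hinput
  have hw₀ : y 2 0 ≠ 0 := fun h => hw (Ideal.Quotient.eq_zero_iff_mem.1 h)
  have not_halted : ∀ t : ℕ, Represents R (fun j => y j t) (run C m t) →
      (run C m t).1 ≠ C.length := by
    rintro t ⟨h₀, -⟩ ht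
    have h := (forall_stepEqs_eq_zero.1 (hstep t)).1
    dsimp only at h h₀
    rw [h₀, ht] at h
    exact guard_natCast_ne_zero _ _ h
  have key : ∀ t : ℕ, Represents R (fun j => y j t) (run C m t) := by
    intro t
    induction t with
    | zero =>
      obtain ⟨-, h₂, h₃, -⟩ := forall_stepEqs_eq_zero.1 (hstep 0)
      simp only [Nat.cast_zero, mul_eq_zero, hw₀, false_or] at h₂ h₃
      refine ⟨by simpa [run_zero] using h₂, fun r hr => ?_⟩
      rcases eq_or_ne r 0 with rfl | hr₀
      · have : y 2 0 * (y 3 0 - m) = 0 := by rw [← hinput]; ring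
        simpa [run_zero, sub_eq_zero] using (mul_eq_zero.1 this).resolve_left hw₀
      · simpa [run_zero, hr₀] using h₃ r hr hr₀
    | succ t ih =>
      rw [run_succ]
      exact ih.step hR ((run_le_length hm t).lt_of_ne (not_halted t ih)) (hstep t)
  obtain ⟨t, ht⟩ := hm
  exact not_halted t (key t) ht

/-- The values of the unknowns other than `2` at a place where the machine is in configuration
`c`, or, for `none`, at a place where it is inactive. The latter has its own instruction number,
one more than that of the halting configuration. -/
noncomputable def stateValue (A : Type*) [Field A] (C : List Instr) :
    Option (ℕ × (ℕ → ℕ)) → ℕ → A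
  | none, 0 => (C.length + 1 : ℕ)
  | some c, 0 => c.1
  | some c, 1 => auxValue A C c
  | some c, r + 3 => c.2 r
  | _, _ => 0

/-- If the machine does not halt on input `m`, then its run yields a solution. The places are
numbered by `τ`, where `none` marks the places before the start of the run. -/
theorem hasSolutionInSequences_of_not_halts {A : Type*} [Field A] [CharZero A] [Algebra F A]
    {τ : M → Option ℕ} (hτ₀ : τ 0 = some 0) (hτ₁ : ∀ l t, τ l = some t → τ (l + 1) = some (t + 1))
    {C : List Instr} {R : ℕ} (hR₀ : 0 < R) (hR : ∀ I ∈ C, Below R I) {m : ℕ}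
    (hm : ∀ t, (run C m t).1 < C.length) :
    HasSolutionInSequences A (R + 3) (inputEq M F R m :: stepSystem M F C R)
      (unknown R 0 2) := by
  -- unknown `2` is the indicator of the place where the run starts
  let z : ℕ → M → A := fun j l =>
    if j = 2 then if τ l = some 0 then 1 else 0 else stateValue A C ((τ l).map (run C m)) j
  let x : Fin (R + 3) → M → A := fun j l => z j l
  have unknown_eq : ∀ (l m : M), ∀ j < R + 3,
      aeval (fun p : Fin (R + 3) × M => x p.1 (l + p.2)) (unknown (F := F) R m j) =
        z j (l + m) := by
    intro l m j hj
    simp [unknown, x, Nat.mod_eq_of_lt hj]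
  refine ⟨x, fun f hf => funext fun l => ?_, fun h => ?_⟩
  · rw [eval_apply]
    have hX : ∀ j < R + 3, aeval (fun p : Fin (R + 3) × M => x p.1 (l + p.2))
        (unknown (F := F) R 0 j) = z j l := fun j hj => by
      rw [unknown_eq l 0 j hj, add_zero]
    have hY := unknown_eq l 1
    have hz₂ : z 2 l = if τ l = some 0 then 1 else 0 := rfl
    rcases List.mem_cons.1 hf with rfl | hf
    · simp only [inputEq, map_add, map_mul, hX 2 (by omega), hX 3 (by omega), map_neg,
        map_natCast, hz₂]
      split_ifs with h
      · simp [z, h, stateValue, run_zero]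
      · simp
    · have hmap := map_stepEqs (aeval (fun p : Fin (R + 3) × M => x p.1 (l + p.2)) :
        DiffPoly M F (R + 3) →ₐ[F] A).toRingHom C R (unknown R 0) (unknown R 1)
      simp only [AlgHom.toRingHom_eq_coe, RingHom.coe_coe] at hmap
      have hmem := List.mem_map_of_mem (f := aeval fun p : Fin (R + 3) × M => x p.1 (l + p.2)) hf
      rw [stepSystem, hmap] at hmem
      rcases hτ : τ l with _ | t
      · refine stepEqs_eq_zero_of_inactive ?_ ?_ _ hmem
        · simp [hX 0 (by omega), z, hτ, stateValue]
        · simp [hX 2 (by omega), z, hτ]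
      · refine Represents.stepEqs_eq_zero hR (hm t) ⟨?_, fun r hr => ?_⟩ ?_ ?_ ?_ _ hmem
        · simp [hX 0 (by omega), z, hτ, stateValue]
        · simp [hX (r + 3) (by omega), z, hτ, stateValue]
        · simp [hX 1 (by omega), z, hτ, stateValue]
        · rw [hX 2 (by omega), hz₂, hτ]
          by_cases ht : t = 0
          · exact .inr (by simp +contextual [ht, run_zero])
          · exact .inl (by simp [ht])
        · rw [← run_succ]
          refine ⟨?_, fun r hr => ?_⟩
          · simp [hY 0 (by omega), z, hτ₁ l t hτ, stateValue]
          · simp [hY (r + 3) (by omega), z, hτ₁ l t hτ, stateValue]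
  · have := congrFun h 0
    rw [eval_apply, unknown_eq 0 0 2 (by omega)] at this
    simp [z, hτ₀] at this

end System

end DiffPoly

/-! ### Computability of the reduction -/

theorem DiffPolyExpr.toPoly_surjective {M R : Type*} [CommSemiring R] {ν : ℕ → R}
    (hν : Function.Surjective ν) (n : ℕ) :
    Function.Surjective (DiffPolyExpr.toPoly (M := M) (n := n) ν) := by
  intro f
  induction f using MvPolynomial.induction_on with
  | C a =>
    obtain ⟨i, rfl⟩ := hν a
    exact ⟨[(i, [])], by simp [toPoly]⟩
  | add f g hf hg =>
    obtain ⟨e, rfl⟩ := hf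
    obtain ⟨e', rfl⟩ := hg
    exact ⟨e ++ e', by simp [toPoly]⟩
  | mul_X f p hf =>
    obtain ⟨e, rfl⟩ := hf
    refine ⟨e.map fun t => (t.1, t.2 ++ [p]), ?_⟩
    simp [toPoly, Function.comp_def, ← mul_assoc, List.sum_map_mul_right]

theorem IsComputableNumbering.exists_computable_neg_natCast {F : Type*} [Field F] {ν : ℕ → F}
    (hν : IsComputableNumbering ν) : ∃ c : ℕ → ℕ, Computable c ∧ ∀ m, ν (c m) = -(m : F) := by
  obtain ⟨a, ha, hadd⟩ := hν.add_computable
  obtain ⟨z, hz⟩ := hν.surjective 0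
  obtain ⟨i, hi⟩ := hν.surjective (-1)
  refine ⟨fun m => Nat.rec z (fun _ c => a c i) m,
    .nat_rec .id (.const z) (ha.comp (Computable.snd.comp .snd) (.const i)).to₂.to₂, fun m => ?_⟩
  induction m with
  | zero => simpa using hz
  | succ m ih =>
    change ν (a _ i) = _
    rw [hadd, ih, hi]
    push_cast
    ring

/-- A family of inputs in which only one coefficient of one equation depends, computably, on the
parameter is a computable family of inputs. -/
theorem IsDecidableDiffProblem.computablePred {M R : Type*} [Primcodable M] [CommSemiring R]
    {ν : ℕ → R} (hν : Function.Surjective ν)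
    {P : (n : ℕ) → List (DiffPoly M R n) → DiffPoly M R n → Prop}
    (h : IsDecidableDiffProblem ν P) {c : ℕ → ℕ} (hc : Computable c) {n : ℕ}
    (f : ℕ → DiffPoly M R n) (i : ℕ) (L L' : List (Fin n × M))
    (hf : ∀ m, DiffPolyExpr.toPoly ν [(i, L), (c m, L')] = f m)
    (fs : List (DiffPoly M R n)) (g : DiffPoly M R n) :
    ComputablePred fun m => P n (f m :: fs) g := by
  obtain ⟨D, hD, hDP⟩ := h
  obtain ⟨es, rfl⟩ := (List.map_surjective_iff.2 (DiffPolyExpr.toPoly_surjective hν n)) fs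
  obtain ⟨e, rfl⟩ := DiffPolyExpr.toPoly_surjective hν n g
  let lit : List (Fin n × M) → List (ℕ × M) := fun L => L.map fun p => ((p.1 : ℕ), p.2)
  have hinput : Computable fun m => (n, [(i, lit L), (c m, lit L')] ::
      es.map DiffPolyExpr.toInput, e.toInput) :=
    (Computable.const n).pair <| (Computable.list_cons.comp
      (Computable.list_cons.comp (.const _)
        (Computable.list_cons.comp (hc.pair (.const _)) (.const [])))
      (.const _)).pair (.const _)
  refine ComputablePred.computable_iff.2 ⟨_, hD.comp hinput, funext fun m => propext ?_⟩
  rw [← hf m]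
  exact (hDP n ([(i, L), (c m, L')] :: es) e).symm

/-- Undecidability over any monoid `M` of places on which a map `τ` reads off the time that has
passed since place `0`; the value `none` is for places that are not reached from `0`. -/
theorem not_isDecidableDiffProblem {M F A : Type*} [AddMonoidWithOne M] [Primcodable M] [Field F]
    [CharZero F] [Field A] [Algebra F A] {ν : ℕ → F} (hν : IsComputableNumbering ν)
    (τ : M → Option ℕ) (hτ₀ : τ 0 = some 0)
    (hτ₁ : ∀ l t, τ l = some t → τ (l + 1) = some (t + 1)) :
    ¬ IsDecidableDiffProblem ν (HasSolutionInSequences (M := M) (R := F) A) ∧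
      ¬ IsDecidableDiffProblem ν (MemRadicalDifferenceIdeal (M := M) (R := F)) := by
  have : CharZero A := charZero_of_injective_algebraMap (algebraMap F A).injective
  obtain ⟨K, C, hK, halts, not_halts⟩ := exists_machine_not_computablePred
  obtain ⟨R, hR₀, hR⟩ := Instr.exists_below C
  obtain ⟨c, hc, hcν⟩ := hν.exists_computable_neg_natCast
  obtain ⟨i, hi⟩ := hν.surjective 1
  have hmem : ∀ m, K m → MemRadicalDifferenceIdeal (R + 3)
      (DiffPoly.inputEq M F R m :: DiffPoly.stepSystem M F C R) (DiffPoly.unknown R 0 2) :=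
    fun m hm => DiffPoly.memRadicalDifferenceIdeal_of_halts hR (halts m hm)
  have hsol : ∀ m, ¬ K m → HasSolutionInSequences A (R + 3)
      (DiffPoly.inputEq M F R m :: DiffPoly.stepSystem M F C R) (DiffPoly.unknown R 0 2) :=
    fun m hm => DiffPoly.hasSolutionInSequences_of_not_halts hτ₀ hτ₁ hR₀ hR (not_halts m hm)
  have hf : ∀ m, DiffPolyExpr.toPoly ν
      [(i, [(Fin.ofNat (R + 3) 2, (0 : M)), (Fin.ofNat (R + 3) 3, 0)]),
        (c m, [(Fin.ofNat (R + 3) 2, 0)])] = DiffPoly.inputEq M F R m := fun m => by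
    simp [DiffPolyExpr.toPoly, DiffPoly.inputEq, DiffPoly.unknown, hi, hcν]
  constructor
  · intro h
    refine hK ((h.computablePred hν.surjective hc _ i _ _ hf
      (DiffPoly.stepSystem M F C R) (DiffPoly.unknown R 0 2)).not.of_eq fun m => ?_)
    exact ⟨fun hn => by_contra fun hm => hn (hsol m hm), fun hm =>
      DiffPoly.not_hasSolutionInSequences_of_memRadicalDifferenceIdeal A (hmem m hm)⟩
  · intro h
    refine hK ((h.computablePred hν.surjective hc _ i _ _ hf
      (DiffPoly.stepSystem M F C R) (DiffPoly.unknown R 0 2)).of_eq fun m => ?_)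
    exact ⟨fun hn => by_contra fun hm =>
      DiffPoly.not_hasSolutionInSequences_of_memRadicalDifferenceIdeal A hn (hsol m hm), hmem m⟩

theorem mainTheorem4 {k : Type*} [Field k] [CharZero k] (k₀ : Subfield k) (ν : ℕ → k₀)
    (hν : IsComputableNumbering ν) :
    (¬ IsDecidableDiffProblem ν (HasSolutionInSequences (M := ℕ) (R := k₀) k) ∧
      ¬ IsDecidableDiffProblem ν (MemRadicalDifferenceIdeal (M := ℕ) (R := k₀))) ∧
    (¬ IsDecidableDiffProblem ν (HasSolutionInSequences (M := ℤ) (R := k₀) k) ∧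
      ¬ IsDecidableDiffProblem ν (MemRadicalDifferenceIdeal (M := ℤ) (R := k₀))) := by
  refine ⟨not_isDecidableDiffProblem hν some rfl (by simp), not_isDecidableDiffProblem hν
    (fun l => if 0 ≤ l then some l.toNat else none) (by simp) fun l t h => ?_⟩
  simp only [Option.ite_none_right_eq_some, Option.some.injEq] at h ⊢
  omega
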